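/- Let $\mathcal A=(\mathcal P,\mathcal L)$ be an affine plane: any two distinct points lie on exactly one line; through a point off a line $\ell$ there is exactly one line missing $\ell$; there are three non-collinear points. Lines are parallel if they are equal or disjoint. Let $\mathcal A$ be Desarguesian: whenever $k,l,m$ are three distinct lines that are parallel, or concurrent in a point $S$, and $A,A'\in k$, $B,B'\in l$, $C,C'\in m$ (all different from $S$ in the concurrent case) satisfy $AB\parallel A'B'$ and $BC\parallel B'C'$, then $AC\parallel A'C'$. Let $\mathcal A$ have more than four points and be ordered by a relation $[A,B,C]$ ("$B$ is strictly between $A$ and $C$"), in the following sense. (i) On every line: $[A,B,C]$ implies that $A,B,C$ are distinct, and implies $[C,B,A]$; for distinct $A,B,C$ exactly one of $[A,B,C],[B,C,A],[C,A,B]$ holds; $[A,B,C]$ and $[B,C,D]$ imply $[A,B,D]$ and $[A,C,D]$; $[A,B,C]$ and $[C,B,D]$ with $A\ne D$ imply $[D,A,B]$ or $[A,D,B]$. (ii) Every parallel projection of a line onto a line (each point $X$ is sent to the intersection of the target line with the parallel through $X$ to a fixed line that is parallel to neither of the two lines) preserves or reverses the order, i.e. it carries $[A,B,C]$ to $[A',B',C']$.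 Let $O\neq I$ be points of a line $\ell$. For $A,C\in\ell$ choose a point $B\notin\ell$. Let $D$ be the intersection of the parallel to $\ell$ through $B$ with the parallel to $OB$ through $A$; then $A+C$ is the intersection of $\ell$ with the parallel to $CB$ through $D$. Let $E$ be the intersection of $OB$ with the parallel to $IB$ through $A$; then $A\ast C$ is the intersection of $\ell$ with the parallel to $BC$ through $E$. Then these operations do not depend on the choice of $B$, and $\mathbf K=(\ell,+,\ast)$ is a skew field with zero $O$ and one $I$. Put $$\mathbf K_+=\{X\in\ell : [O,X,I]\text{ or }X=I\text{ or }[O,I,X]\},\qquad \mathbf K_-=\{X\in\ell : [X,O,I]\}.$$ Then $\mathbf K$ is the disjoint union $\mathbf K_-\cup\{O\}\cup\mathbf K_+$, the set $\mathbf K_+$ is closed under addition and multiplication, and $\mathbf K_-=-\mathbf K_+$. So $\mathbf K$ is an ordered skew field. -/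

import Mathlib

/-- An affine plane with point set `P`; lines are sets of points. -/
structure AffinePlane (P : Type*) where
  /-- the set of lines -/
  lines : Set (Set P)
  /-- two distinct points lie on exactly one line -/
  existsUnique_line : ∀ A B : P, A ≠ B → ∃! l : Set P, l ∈ lines ∧ A ∈ l ∧ B ∈ l
  /-- through a point off a line there is exactly one line missing the given line -/
  playfair : ∀ A : P, ∀ l ∈ lines, A ∉ l → ∃! m : Set P, m ∈ lines ∧ A ∈ m ∧ m ∩ l = ∅
  /-- there are three points that are not on a common line -/
  exists_noncollinear : ∃ A B C : P, A ≠ B ∧ A ≠ C ∧ B ≠ C ∧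
    ∀ l ∈ lines, ¬ (A ∈ l ∧ B ∈ l ∧ C ∈ l)

namespace AffinePlane

variable {P : Type*} (𝒜 : AffinePlane P)

/-- Parallelism of two lines of a plane: they coincide or do not meet. -/
def Parallel (l m : Set P) : Prop := l = m ∨ l ∩ m = ∅

/-- The points `A, B` lie on a line that is parallel to a line carrying the points `C, D`.
For `A ≠ B` and `C ≠ D` this says `AB ∥ CD`. For `C ≠ D` alone it says that `B` lies on the
line through `A` parallel to `CD` (the case `B = A` included). -/
def ParPts (A B C D : P) : Prop :=
  ∃ m ∈ 𝒜.lines, ∃ n ∈ 𝒜.lines, A ∈ m ∧ B ∈ m ∧ C ∈ n ∧ D ∈ n ∧ Parallel m n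

/-- The points `A, B, C` lie on a common line. -/
def Collinear (A B C : P) : Prop := ∃ m ∈ 𝒜.lines, A ∈ m ∧ B ∈ m ∧ C ∈ m

end AffinePlane

/-- A Desargues affine plane: triangles `ABC`, `A'B'C'` whose corresponding vertices lie on three
distinct lines that are parallel, or that pass through a common point `S`, and that have
`AB ∥ A'B'` and `BC ∥ B'C'`, also have `AC ∥ A'C'`. -/
structure DesarguesAffinePlane (P : Type*) extends AffinePlane P where
  desargues_parallel : ∀ k ∈ lines, ∀ l ∈ lines, ∀ m ∈ lines,
    k ≠ l → l ≠ m → k ≠ m →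
    AffinePlane.Parallel k l → AffinePlane.Parallel l m → AffinePlane.Parallel k m →
    ∀ A ∈ k, ∀ A' ∈ k, ∀ B ∈ l, ∀ B' ∈ l, ∀ C ∈ m, ∀ C' ∈ m,
    toAffinePlane.ParPts A B A' B' → toAffinePlane.ParPts B C B' C' →
    toAffinePlane.ParPts A C A' C'
  desargues_concurrent : ∀ k ∈ lines, ∀ l ∈ lines, ∀ m ∈ lines,
    k ≠ l → l ≠ m → k ≠ m →
    ∀ S : P, S ∈ k → S ∈ l → S ∈ m →
    ∀ A ∈ k, ∀ A' ∈ k, ∀ B ∈ l, ∀ B' ∈ l, ∀ C ∈ m, ∀ C' ∈ m,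
    A ≠ S → A' ≠ S → B ≠ S → B' ≠ S → C ≠ S → C' ≠ S →
    toAffinePlane.ParPts A B A' B' → toAffinePlane.ParPts B C B' C' →
    toAffinePlane.ParPts A C A' C'

/-- The set of points `l` is an ordered line for the betweenness relation `btw`
(`btw A B C` is `[A, B, C]`: the point `B` lies strictly between `A` and `C`). -/
structure IsOrderedLine {P : Type*} (btw : P → P → P → Prop) (l : Set P) : Prop where
  /-- betweenness is a relation between three different points -/
  distinct : ∀ A ∈ l, ∀ B ∈ l, ∀ C ∈ l, btw A B C → A ≠ B ∧ B ≠ C ∧ A ≠ C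
  symm : ∀ A ∈ l, ∀ B ∈ l, ∀ C ∈ l, btw A B C → btw C B A
  exactly_one : ∀ A ∈ l, ∀ B ∈ l, ∀ C ∈ l, A ≠ B → B ≠ C → A ≠ C →
    (btw A B C ∧ ¬ btw B C A ∧ ¬ btw C A B) ∨
    (¬ btw A B C ∧ btw B C A ∧ ¬ btw C A B) ∨
    (¬ btw A B C ∧ ¬ btw B C A ∧ btw C A B)
  chain : ∀ A ∈ l, ∀ B ∈ l, ∀ C ∈ l, ∀ D ∈ l,
    btw A B C → btw B C D → btw A B D ∧ btw A C D
  same_side : ∀ A ∈ l, ∀ B ∈ l, ∀ C ∈ l, ∀ D ∈ l, A ≠ D →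
    btw A B C → btw C B D → btw D A B ∨ btw A D B

namespace AffinePlane

variable {P : Type*} (𝒜 : AffinePlane P)

/-- `f` is the parallel projection of the line `l₁` onto the line `l₂` along the line `d`: the
direction `d` is parallel to neither line, and each `X` and its image `f X` lie on a common
parallel of `d`. -/
def IsParallelProjection (d l₁ l₂ : Set P) (f : l₁ → l₂) : Prop :=
  ¬ Parallel d l₁ ∧ ¬ Parallel d l₂ ∧
    ∀ X : l₁, ∃ n ∈ 𝒜.lines, Parallel n d ∧ (X : P) ∈ n ∧ (f X : P) ∈ n

/-- The plane is ordered by `btw`: every line is an ordered line, and every parallel projection of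
a line onto a line preserves or reverses the ordering. For the (symmetric) betweenness relation
both alternatives say that betweenness is carried over. -/
def IsOrdered (btw : P → P → P → Prop) : Prop :=
  (∀ l ∈ 𝒜.lines, IsOrderedLine btw l) ∧
  ∀ d ∈ 𝒜.lines, ∀ l₁ ∈ 𝒜.lines, ∀ l₂ ∈ 𝒜.lines, ∀ f : l₁ → l₂,
    𝒜.IsParallelProjection d l₁ l₂ f →
    ∀ A B C : l₁, btw A B C → btw (f A) (f B) (f C)

/-- `E` is the sum `A + C` constructed on the line `l = OI`: for some auxiliary point `B` off `l`,
the parallel to `l` through `B` meets the parallel to `OB` through `A` in `D`, and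
the parallel to `CB` through `D` meets `l` in `E`. -/
def IsSum (l : Set P) (O I A C E : l) : Prop :=
  ∃ B : P, B ∉ l ∧ ∃ D : P,
    𝒜.ParPts B D O I ∧ 𝒜.ParPts A D O B ∧ 𝒜.ParPts D E C B

/-- `F` is the product `A ∗ C` constructed on the line `l = OI`: for some auxiliary point `B` off
`l`, the parallel to `IB` through `A` meets `OB` in `E`, and the parallel to `BC` through `E`
meets `l` in `F`. -/
def IsProduct (l : Set P) (O I A C F : l) : Prop :=
  ∃ B : P, B ∉ l ∧ ∃ E : P,
    𝒜.ParPts A E I B ∧ 𝒜.Collinear O B E ∧ 𝒜.ParPts E F B C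

/-- The skew field on the points of the line `l = OI` given by `[DivisionRing l]` is the one
constructed geometrically: zero is `O`, one is `I`, and for every choice of the auxiliary points
sum and product are the points found by the constructions. -/
structure IsConstructedSkewField (l : Set P) (O I : l) [DivisionRing l] : Prop where
  zero_eq : (0 : l) = O
  one_eq : (1 : l) = I
  add_iff : ∀ A C E : l, A + C = E ↔ 𝒜.IsSum l O I A C E
  mul_iff : ∀ A C F : l, A * C = F ↔ 𝒜.IsProduct l O I A C F

end AffinePlane

/-- The positive points of the line `l = OI`: those on the same side of `O` as `I`
(the point `I` included). -/
def positivePoints {P : Type*} (btw : P → P → P → Prop) (l : Set P) (O I : l) : Set l :=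
  {X | btw O X I ∨ X = I ∨ btw O I X}

/-- The negative points of the line `l = OI`: those on the other side of `O`. -/
def negativePoints {P : Type*} (btw : P → P → P → Prop) (l : Set P) (O I : l) : Set l :=
  {X | btw X O I}

/-- The skew field `K` is ordered with negative part `N` and positive part `Q`. -/
structure IsOrderedSkewField (K : Type*) [DivisionRing K] (N Q : Set K) : Prop where
  cover : N ∪ {0} ∪ Q = Set.univ
  zero_notMem_neg : (0 : K) ∉ N
  zero_notMem_pos : (0 : K) ∉ Q
  disjoint : N ∩ Q = ∅
  add_mem : ∀ x ∈ Q, ∀ y ∈ Q, x + y ∈ Q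
  mul_mem : ∀ x ∈ Q, ∀ y ∈ Q, x * y ∈ Q
  neg_iff : ∀ x : K, x ∈ N ↔ -x ∈ Q

namespace AffinePlane

variable {P : Type*} {𝒜 : AffinePlane P}

theorem Parallel.symm {l m : Set P} (h : Parallel l m) : Parallel m l :=
  h.imp Eq.symm fun h => by rwa [Set.inter_comm]

theorem Parallel.eq_of_mem {l m : Set P} (h : Parallel l m) {A : P} (hl : A ∈ l) (hm : A ∈ m) :
    l = m :=
  h.resolve_right fun h => by
    have : A ∈ l ∩ m := ⟨hl, hm⟩
    simp [h] at this

theorem Parallel.trans {l m n : Set P} (hl : l ∈ 𝒜.lines) (hm : m ∈ 𝒜.lines) (hn : n ∈ 𝒜.lines)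
    (h : Parallel l m) (h' : Parallel m n) : Parallel l n := by
  rcases h with rfl | h
  · exact h'
  rcases h' with rfl | h'
  · exact Or.inr h
  by_cases hln : l ∩ n = ∅
  · exact Or.inr hln
  obtain ⟨A, hA, hA'⟩ := Set.nonempty_iff_ne_empty.2 hln
  have hAm : A ∉ m := fun hAm => by
    have : A ∈ l ∩ m := ⟨hA, hAm⟩
    simp [h] at this
  exact Or.inl ((𝒜.playfair A m hm hAm).unique ⟨hl, hA, h⟩ ⟨hn, hA', by rwa [Set.inter_comm]⟩)

theorem line_unique {l m : Set P} (hl : l ∈ 𝒜.lines) (hm : m ∈ 𝒜.lines) {A B : P} (h : A ≠ B)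
    (hAl : A ∈ l) (hBl : B ∈ l) (hAm : A ∈ m) (hBm : B ∈ m) : l = m :=
  (𝒜.existsUnique_line A B h).unique ⟨hl, hAl, hBl⟩ ⟨hm, hAm, hBm⟩

theorem exists_ne (𝒜 : AffinePlane P) (A : P) : ∃ B, B ≠ A := by
  obtain ⟨X, Y, -, h, -⟩ := 𝒜.exists_noncollinear
  by_cases hX : X = A
  · exact ⟨Y, fun hY => h (hX.trans hY.symm)⟩
  · exact ⟨X, hX⟩

theorem exists_line (𝒜 : AffinePlane P) (A B : P) : ∃ l ∈ 𝒜.lines, A ∈ l ∧ B ∈ l := by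
  by_cases h : A = B
  · obtain ⟨C, hC⟩ := 𝒜.exists_ne A
    obtain ⟨l, ⟨hl, hC, hA⟩, -⟩ := 𝒜.existsUnique_line C A hC
    exact ⟨l, hl, hA, h ▸ hA⟩
  · exact (𝒜.existsUnique_line A B h).exists

theorem exists_notMem {l : Set P} (hl : l ∈ 𝒜.lines) : ∃ B, B ∉ l := by
  obtain ⟨A, B, C, -, -, -, h⟩ := 𝒜.exists_noncollinear
  by_contra! hl'
  exact h l hl ⟨hl' A, hl' B, hl' C⟩

theorem exists_parallel {l : Set P} (hl : l ∈ 𝒜.lines) (A : P) :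
    ∃ m ∈ 𝒜.lines, A ∈ m ∧ Parallel l m := by
  by_cases h : A ∈ l
  · exact ⟨l, hl, h, Or.inl rfl⟩
  · obtain ⟨m, ⟨hm, hA, h⟩, -⟩ := 𝒜.playfair A l hl h
    exact ⟨m, hm, hA, Parallel.symm (Or.inr h)⟩

namespace ParPts

variable {A B C D U V W Z D' : P}

theorem symm (h : 𝒜.ParPts A B C D) : 𝒜.ParPts C D A B := by
  obtain ⟨m, hm, n, hn, h1, h2, h3, h4, h⟩ := h
  exact ⟨n, hn, m, hm, h3, h4, h1, h2, h.symm⟩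

theorem swap_left (h : 𝒜.ParPts A B C D) : 𝒜.ParPts B A C D := by
  obtain ⟨m, hm, n, hn, h1, h2, h3, h4, h⟩ := h
  exact ⟨m, hm, n, hn, h2, h1, h3, h4, h⟩

theorem swap_right (h : 𝒜.ParPts A B C D) : 𝒜.ParPts A B D C :=
  h.symm.swap_left.symm

theorem swap (h : 𝒜.ParPts A B C D) : 𝒜.ParPts B A D C :=
  h.swap_left.swap_right

theorem trans (hCD : C ≠ D) (h : 𝒜.ParPts A B C D) (h' : 𝒜.ParPts C D U V) :
    𝒜.ParPts A B U V := by
  obtain ⟨m, hm, n, hn, h1, h2, h3, h4, h⟩ := h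
  obtain ⟨m', hm', n', hn', h1', h2', h3', h4', h'⟩ := h'
  obtain rfl := line_unique hn hm' hCD h3 h4 h1' h2'
  exact ⟨m, hm, n', hn', h1, h2, h3', h4', h.trans hm hn hn' h'⟩

theorem mem {l : Set P} (hl : l ∈ 𝒜.lines) (hU : U ∈ l) (hV : V ∈ l) (hUV : U ≠ V)
    (h : 𝒜.ParPts U V A B) (hA : A ∈ l) : B ∈ l := by
  obtain ⟨m, hm, n, hn, h1, h2, h3, h4, h⟩ := h
  obtain rfl := line_unique hl hm hUV hU hV h1 h2
  rwa [h.eq_of_mem hA h3]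

theorem of_mem {l : Set P} (hl : l ∈ 𝒜.lines) (hA : A ∈ l) (hB : B ∈ l) (hC : C ∈ l)
    (hD : D ∈ l) : 𝒜.ParPts A B C D :=
  ⟨l, hl, l, hl, hA, hB, hC, hD, Or.inl rfl⟩

theorem concat (hUV : U ≠ V) (h : 𝒜.ParPts U V A B) (h' : 𝒜.ParPts U V B C) :
    𝒜.ParPts U V A C := by
  obtain ⟨m, hm, n, hn, h1, h2, h3, h4, h⟩ := h
  obtain ⟨m', hm', n', hn', h1', h2', h3', h4', h'⟩ := h'
  obtain rfl := line_unique hm hm' hUV h1 h2 h1' h2'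
  obtain rfl := (h.symm.trans hn hm hn' h').eq_of_mem h4 h3'
  exact ⟨m, hm, n, hn, h1, h2, h3, h4', h⟩

theorem self_right (𝒜 : AffinePlane P) (A B C : P) : 𝒜.ParPts A B C C := by
  obtain ⟨m, hm, hA, hB⟩ := 𝒜.exists_line A B
  obtain ⟨n, hn, hC, h⟩ := exists_parallel hm C
  exact ⟨m, hm, n, hn, hA, hB, hC, hC, h⟩

theorem self_left (𝒜 : AffinePlane P) (A B C : P) : 𝒜.ParPts C C A B :=
  (self_right 𝒜 A B C).symm

theorem refl (𝒜 : AffinePlane P) (A B : P) : 𝒜.ParPts A B A B := by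
  obtain ⟨m, hm, hA, hB⟩ := 𝒜.exists_line A B
  exact of_mem hm hA hB hA hB

/-- Two intersections of the same pair of non-parallel lines coincide. -/
theorem inter_unique (hUV : U ≠ V) (hWZ : W ≠ Z) (hn : ¬ 𝒜.ParPts U V W Z)
    (h1 : 𝒜.ParPts U V A D) (h2 : 𝒜.ParPts U V A D')
    (h3 : 𝒜.ParPts W Z B D) (h4 : 𝒜.ParPts W Z B D') : D = D' := by
  by_contra hD
  exact hn ((concat hUV h1.swap_right h2).trans hD (concat hWZ h3.swap_right h4).symm)

theorem exists_inter (A B : P) (hn : ¬ 𝒜.ParPts U V W Z) :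
    ∃ D, 𝒜.ParPts U V A D ∧ 𝒜.ParPts W Z B D := by
  obtain ⟨m, hm, hU, hV⟩ := 𝒜.exists_line U V
  obtain ⟨n, hN, hW, hZ⟩ := 𝒜.exists_line W Z
  obtain ⟨m', hm', hA, hp⟩ := exists_parallel hm A
  obtain ⟨n', hn', hB, hp'⟩ := exists_parallel hN B
  have : m' ∩ n' ≠ ∅ := fun h => hn ⟨m, hm, n, hN, hU, hV, hW, hZ,
    (hp.trans hm hm' hn' (Or.inr h)).trans hm hn' hN hp'.symm⟩
  obtain ⟨D, hD, hD'⟩ := Set.nonempty_iff_ne_empty.2 this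
  exact ⟨D, ⟨m, hm, m', hm', hU, hV, hA, hD, hp⟩, ⟨n, hN, n', hn', hW, hZ, hB, hD', hp'⟩⟩

theorem not_of_notMem {l : Set P} (hl : l ∈ 𝒜.lines) (hA : A ∈ l) (hB : B ∈ l) (hAB : A ≠ B)
    (hC : C ∈ l) (hD : D ∉ l) : ¬ 𝒜.ParPts A B C D :=
  fun h => hD (h.mem hl hA hB hAB hC)

end ParPts

/-- A map that sends every line into a parallel line. Constant maps are included. -/
def IsDil (𝒜 : AffinePlane P) (f : P → P) : Prop := ∀ X Y, 𝒜.ParPts X Y (f X) (f Y)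

theorem isDil_id (𝒜 : AffinePlane P) : 𝒜.IsDil id := fun X Y => ParPts.refl 𝒜 X Y

theorem isDil_const (𝒜 : AffinePlane P) (A : P) : 𝒜.IsDil fun _ => A :=
  fun X Y => ParPts.self_right 𝒜 X Y A

theorem IsDil.parPts {f : P → P} (hf : 𝒜.IsDil f) {A B C D : P} (h : 𝒜.ParPts A B C D) :
    𝒜.ParPts A B (f C) (f D) := by
  by_cases hCD : C = D
  · subst hCD
    exact ParPts.self_right _ _ _ _
  · exact h.trans hCD (hf C D)

theorem IsDil.comp {f g : P → P} (hf : 𝒜.IsDil f) (hg : 𝒜.IsDil g) : 𝒜.IsDil (f ∘ g) :=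
  fun X Y => hf.parPts (hg X Y)

theorem IsDil.map_mem {f : P → P} (hf : 𝒜.IsDil f) {l : Set P} (hl : l ∈ 𝒜.lines) {A B : P}
    (hA : A ∈ l) (hfA : f A ∈ l) (hB : B ∈ l) : f B ∈ l := by
  by_cases h : A = B
  · exact h ▸ hfA
  · exact (hf A B).mem hl hA hB h hfA

theorem exists_not_parPts {A B : P} (h : A ≠ B) : ∃ C, ¬ 𝒜.ParPts A B A C := by
  obtain ⟨m, hm, hA, hB⟩ := 𝒜.exists_line A B
  obtain ⟨C, hC⟩ := exists_notMem hm
  exact ⟨C, ParPts.not_of_notMem hm hA hB h hA hC⟩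

theorem IsDil.eq_off {f g : P → P} (hf : 𝒜.IsDil f) (hg : 𝒜.IsDil g) {A B C : P}
    (hA : f A = g A) (hB : f B = g B) (hC : ¬ 𝒜.ParPts A B A C) : f C = g C := by
  have hAC : A ≠ C := by
    rintro rfl
    exact hC (ParPts.self_right _ _ _ _)
  have hBC : B ≠ C := by
    rintro rfl
    exact hC (ParPts.refl _ _ _)
  refine ParPts.inter_unique hAC hBC (fun h' => hC ?_) (hf A C) (hA ▸ hg A C) (hf B C)
    (hB ▸ hg B C)
  obtain ⟨m, hm, hA, hC⟩ := 𝒜.exists_line A C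
  have := h'.swap_right.mem hm hA hC hAC hC
  exact ParPts.of_mem hm hA this hA hC

/-- A dilatation is determined by the images of two points. -/
theorem IsDil.ext {f g : P → P} (hf : 𝒜.IsDil f) (hg : 𝒜.IsDil g) {A B : P} (h : A ≠ B)
    (hA : f A = g A) (hB : f B = g B) : f = g := by
  funext C
  by_cases hC : 𝒜.ParPts A B A C
  · by_cases hAC : A = C
    · exact hAC ▸ hA
    obtain ⟨D, hD⟩ := exists_not_parPts (𝒜 := 𝒜) h
    have hAD : A ≠ D := by
      rintro rfl
      exact hD (ParPts.self_right _ _ _ _)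
    refine hf.eq_off hg hA (hf.eq_off hg hA hB hD) fun h' => hD ?_
    exact hC.trans hAC h'.symm
  · exact hf.eq_off hg hA hB hC

/-- A dilatation that is the identity or has no fixed point. -/
def IsTrans (𝒜 : AffinePlane P) (f : P → P) : Prop := 𝒜.IsDil f ∧ (f = id ∨ ∀ X, f X ≠ X)

theorem isTrans_id (𝒜 : AffinePlane P) : 𝒜.IsTrans id := ⟨isDil_id 𝒜, Or.inl rfl⟩

theorem IsTrans.eq_id {f : P → P} (hf : 𝒜.IsTrans f) {A : P} (h : f A = A) : f = id :=
  hf.2.resolve_right fun h' => h' A h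

theorem IsTrans.parPts_trace {f : P → P} (hf : 𝒜.IsTrans f) (X Y : P) :
    𝒜.ParPts X (f X) Y (f Y) := by
  rcases hf.2 with rfl | h
  · exact ParPts.self_right _ _ _ _
  obtain ⟨m, hm, hX, hX'⟩ := 𝒜.exists_line X (f X)
  obtain ⟨n, hn, hY, hY'⟩ := 𝒜.exists_line Y (f Y)
  refine ⟨m, hm, n, hn, hX, hX', hY, hY', ?_⟩
  by_cases hmn : m ∩ n = ∅
  · exact Or.inr hmn
  obtain ⟨Z, hZ, hZ'⟩ := Set.nonempty_iff_ne_empty.2 hmn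
  exact Or.inl (line_unique hm hn (h Z).symm hZ (hf.1.map_mem hm hX hX' hZ) hZ'
    (hf.1.map_mem hn hY hY' hZ'))

theorem IsTrans.ext {f g : P → P} (hf : 𝒜.IsTrans f) (hg : 𝒜.IsTrans g) {A : P}
    (h : f A = g A) : f = g := by
  by_cases hA : f A = A
  · rw [hf.eq_id hA, hg.eq_id (h ▸ hA)]
  obtain ⟨B, hB⟩ := exists_not_parPts (𝒜 := 𝒜) (Ne.symm hA)
  have hAB : A ≠ B := by
    rintro rfl
    exact hB (ParPts.self_right _ _ _ _)
  refine hf.1.ext hg.1 hAB h ?_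
  exact ParPts.inter_unique (Ne.symm hA) hAB hB (hf.parPts_trace A B)
    (h ▸ hg.parPts_trace A B) (hf.1 A B) (h ▸ hg.1 A B)

theorem IsTrans.comp {f g : P → P} (hf : 𝒜.IsTrans f) (hg : 𝒜.IsTrans g) :
    𝒜.IsTrans (f ∘ g) := by
  have hd := hf.1.comp hg.1
  refine ⟨hd, ?_⟩
  by_contra! hne
  obtain ⟨hid, A, hA⟩ := hne
  by_cases hgA : g A = A
  · rw [hg.eq_id hgA] at hid hA
    exact hid (hf.eq_id hA)
  obtain ⟨B, hB⟩ := exists_not_parPts (𝒜 := 𝒜) (Ne.symm hgA)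
  have hAB : A ≠ B := by
    rintro rfl
    exact hB (ParPts.self_right _ _ _ _)
  refine hid (hd.ext (isDil_id 𝒜) hAB hA ?_)
  refine ParPts.inter_unique (Ne.symm hgA) hAB hB (A := B) ?_ (ParPts.self_right _ _ _ _)
    (B := A) ?_ (ParPts.refl _ _ _)
  · have h := (hf.parPts_trace (g A) (g B)).swap_left
    rw [show f (g A) = A from hA] at h
    exact (hg.parPts_trace A B).concat (Ne.symm hgA) h
  · have h := hd A B
    rwa [hA] at h

theorem IsTrans.comm_of_not_parPts {f g : P → P} (hf : 𝒜.IsTrans f) (hg : 𝒜.IsTrans g) {A : P}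
    (hn : ¬ 𝒜.ParPts A (f A) A (g A)) : f ∘ g = g ∘ f := by
  refine (hf.comp hg).ext (hg.comp hf) (A := A) ?_
  have h1 : A ≠ f A := fun h => hn (by rw [← h]; exact ParPts.self_left _ _ _ _)
  have h2 : A ≠ g A := fun h => hn (by rw [← h]; exact ParPts.self_right _ _ _ _)
  exact ParPts.inter_unique h1 h2 hn (hf.parPts_trace A (g A)) (hg.1 A (f A))
    (hf.1 A (g A)) (hg.parPts_trace A (f A))

/-- Desargues' configurations in a pencil of lines (through a point, or parallel) yield
dilatations that leave the lines of the pencil invariant. -/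
theorem exists_pencil_dilatation (R : Set P) (g : P → Set P)
    (hg : ∀ X ∈ R, g X ∈ 𝒜.lines ∧ X ∈ g X)
    (hD : ∀ X ∈ R, ∀ Y ∈ R, ∀ Z ∈ R, g X ≠ g Y → g Y ≠ g Z → g X ≠ g Z →
      ∀ X' ∈ g X ∩ R, ∀ Y' ∈ g Y ∩ R, ∀ Z' ∈ g Z ∩ R,
      𝒜.ParPts X Y X' Y' → 𝒜.ParPts Y Z Y' Z' → 𝒜.ParPts X Z X' Z')
    (hex : ∀ X ∈ R, ∀ Y ∈ R, g X ≠ g Y → ∀ X' ∈ g X ∩ R, ∃ Y' ∈ g Y ∩ R, 𝒜.ParPts X Y X' Y')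
    (h3 : ∀ X ∈ R, ∀ Y ∈ R, ∃ Z ∈ R, g Z ≠ g X ∧ g Z ≠ g Y)
    {I A : P} (hI : I ∈ R) (hA : A ∈ g I ∩ R) :
    ∃ f : P → P, f I = A ∧ (∀ X ∈ R, f X ∈ g X ∩ R) ∧
      ∀ X ∈ R, ∀ Y ∈ R, 𝒜.ParPts X Y (f X) (f Y) := by
  classical
  have same : ∀ X ∈ R, ∀ Y ∈ R, g X = g Y → ∀ X' ∈ g X ∩ R, ∀ Y' ∈ g Y ∩ R,
      𝒜.ParPts X Y X' Y' := fun X hX Y hY h X' hX' Y' hY' =>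
    ParPts.of_mem (hg X hX).1 (hg X hX).2 (h ▸ (hg Y hY).2) hX'.1 (h ▸ hY'.1)
  have hex1 : ∀ X, ∃ X', X ∈ R → g I ≠ g X → X' ∈ g X ∩ R ∧ 𝒜.ParPts I X A X' := by
    intro X
    by_cases h : X ∈ R ∧ g I ≠ g X
    · obtain ⟨X', h1, h2⟩ := hex I hI X h.1 h.2 A hA
      exact ⟨X', fun _ _ => ⟨h1, h2⟩⟩
    · exact ⟨X, fun h1 h2 => (h ⟨h1, h2⟩).elim⟩
  choose k hk using hex1
  have hkk : ∀ X ∈ R, ∀ Y ∈ R, g I ≠ g X → g I ≠ g Y → 𝒜.ParPts X Y (k X) (k Y) := by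
    intro X hX Y hY h h'
    by_cases hXY : g X = g Y
    · exact same X hX Y hY hXY _ (hk X hX h).1 _ (hk Y hY h').1
    · exact hD X hX I hI Y hY h.symm h' hXY _ (hk X hX h).1 A hA _ (hk Y hY h').1
        (hk X hX h).2.swap (hk Y hY h').2
  obtain ⟨W, hW, hWI, -⟩ := h3 I hI I hI
  have hex2 : ∀ X, ∃ X', X ∈ R → g I = g X → X' ∈ g X ∩ R ∧
      ∀ Y ∈ R, g I ≠ g Y → 𝒜.ParPts X Y X' (k Y) := by
    intro X
    by_cases h : X ∈ R ∧ g I = g X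
    · obtain ⟨hX, hIX⟩ := h
      obtain ⟨X', hX', hp⟩ := hex W hW X hX (hIX ▸ hWI) (k W) (hk W hW hWI.symm).1
      refine ⟨X', fun _ _ => ⟨hX', ?_⟩⟩
      have key : ∀ V ∈ R, g I ≠ g V → 𝒜.ParPts X V X' (k V) → ∀ Y ∈ R, g I ≠ g Y → g V ≠ g Y →
          𝒜.ParPts X Y X' (k Y) := fun V hV hIV hp Y hY hIY hVY =>
        hD X hX V hV Y hY (hIX ▸ hIV) hVY (hIX ▸ hIY) X' hX' _ (hk V hV hIV).1 _ (hk Y hY hIY).1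
          hp (hkk V hV Y hY hIV hIY)
      intro Y hY hIY
      obtain ⟨V, hV, hVI, hVW⟩ := h3 I hI W hW
      by_cases hWY : g W = g Y
      · exact key V hV hVI.symm (key W hW hWI.symm hp.swap V hV hVI.symm hVW.symm) Y hY hIY
          (hWY ▸ hVW)
      · exact key W hW hWI.symm hp.swap Y hY hIY hWY
    · exact ⟨X, fun h1 h2 => (h ⟨h1, h2⟩).elim⟩
  choose k' hk' using hex2
  let f : P → P := fun X => if X = I then A else if g I = g X then k' X else k X
  have hf1 : ∀ X ∈ R, g I = g X → f X ∈ g X ∩ R ∧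
      ∀ Y ∈ R, g I ≠ g Y → 𝒜.ParPts X Y (f X) (k Y) := by
    intro X hX h
    by_cases hXI : X = I
    · subst hXI
      simpa [f] using ⟨hA, fun Y hY hIY => (hk Y hY hIY).2⟩
    · simpa [f, hXI, h] using hk' X hX h
  have hf2 : ∀ X, g I ≠ g X → f X = k X := by
    intro X h
    have : X ≠ I := by
      rintro rfl
      exact h rfl
    simp [f, this, h]
  have hf3 : ∀ X ∈ R, f X ∈ g X ∩ R := by
    intro X hX
    by_cases h : g I = g X
    · exact (hf1 X hX h).1
    · exact hf2 X h ▸ (hk X hX h).1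
  refine ⟨f, by simp [f], hf3, fun X hX Y hY => ?_⟩
  by_cases h : g I = g X <;> by_cases h' : g I = g Y
  · exact same X hX Y hY (h ▸ h') _ (hf3 X hX) _ (hf3 Y hY)
  · rw [hf2 Y h']
    exact (hf1 X hX h).2 Y hY h'
  · rw [hf2 X h]
    exact ((hf1 Y hY h').2 X hX h).swap
  · rw [hf2 X h, hf2 Y h']
    exact hkk X hX Y hY h h'

end AffinePlane

namespace AffinePlane

variable {P : Type*} {𝒜 : AffinePlane P}

theorem ParPts.mem_of_parallel {l m : Set P} (hl : l ∈ 𝒜.lines) (hm : m ∈ 𝒜.lines)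
    (hlm : Parallel l m) {U V A B : P} (hU : U ∈ l) (hV : V ∈ l) (hUV : U ≠ V)
    (h : 𝒜.ParPts U V A B) (hA : A ∈ m) : B ∈ m := by
  obtain ⟨l', hl', n, hn, h1, h2, h3, h4, h⟩ := h
  obtain rfl := line_unique hl hl' hUV hU hV h1 h2
  rwa [(hlm.symm.trans hm hl hn h).eq_of_mem hA h3]

/-- In a plane covered by two parallel lines, these lines do not have three points. -/
theorem not_three_of_parallel_cover {m n : Set P} (hm : m ∈ 𝒜.lines) (hn : n ∈ 𝒜.lines)
    (hmn : m ∩ n = ∅) (hcov : ∀ Z, Z ∈ m ∨ Z ∈ n) {X A B C : P} (hX : X ∈ m)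
    (hA : A ∈ n) (hB : B ∈ n) (hC : C ∈ n) (hAB : A ≠ B) (hBC : B ≠ C) (hAC : A ≠ C) : False := by
  have disj : ∀ {Z}, Z ∈ m → Z ∉ n := fun {Z} h h' => by
    have : Z ∈ m ∩ n := ⟨h, h'⟩
    simp [hmn] at this
  obtain ⟨X', h1, h2⟩ := ParPts.exists_inter (𝒜 := 𝒜) (U := X) (V := A) (W := A) (Z := B) B X
    fun h => ParPts.not_of_notMem hn hA hB hAB hA (disj hX) h.symm.swap_right
  have hX' : X' ∈ m :=
    h2.mem_of_parallel hn hm (Parallel.symm (Or.inr hmn)) hA hB hAB hX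
  obtain ⟨p, hp, hXp, hAp⟩ := 𝒜.exists_line X A
  have hXA : X ≠ A := fun h => disj hX (h ▸ hA)
  have eq_n : ∀ {q}, q ∈ 𝒜.lines → ∀ {Z Y Y'}, Z ∈ m → Z ∈ q → Y ∈ n → Y ∈ q → Y' ∈ n →
      Y' ∈ q → Y = Y' := by
    intro q hq Z Y Y' hZ hZq hY hYq hY' hYq'
    by_contra h
    exact disj hZ (line_unique hq hn h hYq hYq' hY hY' ▸ hZq)
  have eq_m : ∀ {q}, q ∈ 𝒜.lines → ∀ {Z Y Y'}, Z ∈ n → Z ∈ q → Y ∈ m → Y ∈ q → Y' ∈ m →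
      Y' ∈ q → Y = Y' := by
    intro q hq Z Y Y' hZ hZq hY hYq hY' hYq'
    by_contra h
    exact disj (line_unique hq hm h hYq hYq' hY hY' ▸ hZq) hZ
  have hXX' : X ≠ X' := by
    rintro rfl
    exact hAB (eq_n hp hX hXp hA hAp hB (h1.swap_right.mem hp hXp hAp hXA hXp))
  have hXp' : X' ∉ p := fun h => hXX' (eq_m hp hA hAp hX hXp hX' h)
  have miss : ∀ {Y}, Y ∈ n → A ≠ Y → ∀ {q}, q ∈ 𝒜.lines → X' ∈ q → Y ∈ q → q ∩ p = ∅ := by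
    intro Y hY hAY q hq hXq hYq
    refine Set.eq_empty_iff_forall_notMem.2 fun Z hZ => ?_
    rcases hcov Z with h | h
    · exact hXp' (eq_m hq hY hYq h hZ.1 hX' hXq ▸ hZ.2)
    · exact hAY (eq_n hp hX hXp hA hAp hY (eq_n hq hX' hXq h hZ.1 hY hYq ▸ hZ.2))
  obtain ⟨q, hq, hXq, hBq⟩ := 𝒜.exists_line X' B
  obtain ⟨r, hr, hXr, hCr⟩ := 𝒜.exists_line X' C
  obtain rfl := (𝒜.playfair X' p hp hXp').unique ⟨hq, hXq, miss hB hAB hq hXq hBq⟩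
    ⟨hr, hXr, miss hC hAC hr hXr hCr⟩
  exact hBC (eq_n hq hX' hXq hB hBq hC hCr)

theorem exists_notMem_of_parallel (hcard : 4 < ENat.card P) {m n : Set P} (hm : m ∈ 𝒜.lines)
    (hn : n ∈ 𝒜.lines) (hmn : Parallel m n) : ∃ Z, Z ∉ m ∧ Z ∉ n := by
  rcases hmn with rfl | hmn
  · exact (exists_notMem hm).imp fun _ h => ⟨h, h⟩
  by_contra! hcov
  have small : ∀ {m n : Set P}, m ∈ 𝒜.lines → n ∈ 𝒜.lines → m ∩ n = ∅ →
      (∀ Z, Z ∈ m ∨ Z ∈ n) → n.encard ≤ 2 := by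
    intro m n hm hn hmn hcov
    by_contra! h
    obtain ⟨t, ht, h3⟩ := Set.exists_subset_encard_eq (Order.add_one_le_of_lt h)
    obtain ⟨A, B, C, hAB, hAC, hBC, rfl⟩ := Set.encard_eq_three.1 (h3.trans (by norm_num))
    obtain ⟨X, hX⟩ := exists_notMem hn
    exact not_three_of_parallel_cover hm hn hmn hcov ((hcov X).resolve_right hX)
      (ht (by simp)) (ht (by simp)) (ht (by simp)) hAB hBC hAC
  have hcov' : ∀ Z, Z ∈ m ∨ Z ∈ n := fun Z => or_iff_not_imp_left.2 (hcov Z)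
  have h1 := small hm hn hmn hcov'
  have h2 := small hn hm (by rwa [Set.inter_comm]) fun Z => (hcov' Z).symm
  have h3 : m ∪ n = Set.univ := Set.eq_univ_of_forall hcov'
  have h4 := Set.encard_union_le m n
  rw [h3, Set.encard_univ] at h4
  have := hcard.trans_le (h4.trans (add_le_add h2 h1))
  norm_num at this

end AffinePlane

namespace DesarguesAffinePlane

open AffinePlane

variable {P : Type*} {𝒜 : DesarguesAffinePlane P}

theorem exists_homothety {l : Set P} (hl : l ∈ 𝒜.lines) {O I A : P} (hO : O ∈ l) (hI : I ∈ l)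
    (hA : A ∈ l) (hOI : O ≠ I) :
    ∃ f, 𝒜.IsDil f ∧ f O = O ∧ f I = A := by
  classical
  by_cases hOA : A = O
  · exact ⟨_, isDil_const 𝒜.toAffinePlane O, rfl, hOA.symm⟩
  choose g hg hOg hXg using 𝒜.exists_line O
  have geq : ∀ {X Y}, Y ≠ O → Y ∈ g X → g X = g Y := fun {X Y} hY h =>
    line_unique (hg X) (hg Y) hY h (hOg X) (hXg Y) (hOg Y)
  obtain ⟨f, hfI, hf1, hf2⟩ := exists_pencil_dilatation (𝒜 := 𝒜.toAffinePlane) {X | X ≠ O} g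
    (fun X _ => ⟨hg X, hXg X⟩)
    (fun X hX Y hY Z hZ h1 h2 h3 X' hX' Y' hY' Z' hZ' h4 h5 =>
      𝒜.desargues_concurrent _ (hg X) _ (hg Y) _ (hg Z) h1 h2 h3 O (hOg X) (hOg Y) (hOg Z)
        X (hXg X) X' hX'.1 Y (hXg Y) Y' hY'.1 Z (hXg Z) Z' hZ'.1 hX hX'.2 hY hY'.2 hZ hZ'.2 h4 h5)
    (by
      intro X hX Y hY hXY X' hX'
      have hXY' : X ≠ Y := by
        rintro rfl
        exact hXY rfl
      obtain ⟨Y', h1, h2⟩ := ParPts.exists_inter (𝒜 := 𝒜.toAffinePlane) (U := X) (V := Y) (W := O)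
        (Z := Y) X' O fun h => by
          obtain ⟨m, hm, hXm, hYm⟩ := 𝒜.exists_line X Y
          have := h.swap_right.mem hm hXm hYm hXY' hYm
          exact hXY ((line_unique (hg X) hm hX (hXg X) (hOg X) hXm this).trans
            (line_unique hm (hg Y) hY hYm this (hXg Y) (hOg Y)))
      refine ⟨Y', ⟨h2.mem (hg Y) (hOg Y) (hXg Y) (Ne.symm hY) (hOg Y), ?_⟩, h1⟩
      rintro rfl
      exact hXY (geq hY (h1.symm.mem (hg X) hX'.1 (hOg X) hX'.2 (hXg X))))
    (by
      intro X hX Y hY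
      by_cases hXY : g X = g Y
      · obtain ⟨Z, hZ⟩ := exists_notMem (hg X)
        refine ⟨Z, fun h => hZ (h ▸ hOg X), ?_⟩
        rw [← hXY, and_self]
        exact fun h => hZ (h ▸ hXg Z)
      · obtain ⟨Z, h1, h2⟩ := ParPts.exists_inter (𝒜 := 𝒜.toAffinePlane) (U := O) (V := X)
          (W := O) (Z := Y) Y X fun h => hXY (geq hY (h.mem (hg X) (hOg X) (hXg X) (Ne.symm hX)
            (hOg X)))
        have hZX : Z ∉ g X := fun h => hXY (geq hY (h1.swap_right.mem (hg X) (hOg X) (hXg X)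
          (Ne.symm hX) h))
        have hZY : Z ∉ g Y := fun h => hXY (geq hX (h2.swap_right.mem (hg Y) (hOg Y) (hXg Y)
          (Ne.symm hY) h)).symm
        exact ⟨Z, fun h => hZX (h ▸ hOg X), fun h => hZX (h ▸ hXg Z), fun h => hZY (h ▸ hXg Z)⟩)
    (I := I) (A := A) hOI.symm
    ⟨line_unique hl (hg I) hOI hO hI (hOg I) (hXg I) ▸ hA, hOA⟩
  refine ⟨fun X => if X = O then O else f X, fun X Y => ?_, by simp, by simp [hOI.symm, hfI]⟩
  have hO : ∀ Y, Y ≠ O → 𝒜.ParPts O Y O (f Y) := fun Y hY =>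
    ParPts.of_mem (hg Y) (hOg Y) (hXg Y) (hOg Y) (hf1 Y hY).1
  by_cases hX : X = O <;> by_cases hY : Y = O
  · simp only [hX, hY, if_true]
    exact ParPts.refl _ _ _
  · simpa only [hX, hY, if_true, if_false] using hO Y hY
  · simpa only [hX, hY, if_true, if_false] using (hO X hX).swap
  · simpa only [hX, hY, if_false] using hf2 X hX Y hY

theorem exists_translation (hcard : 4 < ENat.card P) (O A : P) :
    ∃ f, 𝒜.IsTrans f ∧ f O = A := by
  by_cases hOA : O = A
  · exact ⟨id, isTrans_id _, hOA⟩
  obtain ⟨d, hd, hO, hA⟩ := 𝒜.exists_line O A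
  choose g hg hXg hdg using exists_parallel hd
  have gpar : ∀ X Y, Parallel (g X) (g Y) := fun X Y =>
    (hdg X).symm.trans (hg X) hd (hg Y) (hdg Y)
  have geq : ∀ {X Y}, Y ∈ g X → g X = g Y := fun {X Y} h => (gpar X Y).eq_of_mem h (hXg Y)
  have hmem : ∀ {X Y}, 𝒜.ParPts O A X Y → Y ∈ g X := fun {X Y} h =>
    h.mem_of_parallel hd (hg X) (hdg X) hO hA hOA (hXg X)
  have hgd : g O = d := (hdg O).symm.eq_of_mem (hXg O) hO
  obtain ⟨f, hfI, hf1, hf2⟩ := exists_pencil_dilatation (𝒜 := 𝒜.toAffinePlane) Set.univ g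
    (fun X _ => ⟨hg X, hXg X⟩)
    (fun X _ Y _ Z _ h1 h2 h3 X' hX' Y' hY' Z' hZ' h4 h5 =>
      𝒜.desargues_parallel _ (hg X) _ (hg Y) _ (hg Z) h1 h2 h3 (gpar X Y) (gpar Y Z) (gpar X Z)
        X (hXg X) X' hX'.1 Y (hXg Y) Y' hY'.1 Z (hXg Z) Z' hZ'.1 h4 h5)
    (by
      intro X _ Y _ hXY X' hX'
      obtain ⟨Y', h1, h2⟩ := ParPts.exists_inter (𝒜 := 𝒜.toAffinePlane) (U := X) (V := Y) (W := O)
        (Z := A) X' Y fun h => hXY (geq (hmem h.symm))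
      exact ⟨Y', ⟨hmem h2, trivial⟩, h1⟩)
    (by
      intro X _ Y _
      obtain ⟨Z, h1, h2⟩ := exists_notMem_of_parallel hcard (hg X) (hg Y) (gpar X Y)
      exact ⟨Z, trivial, fun h => h1 (h ▸ hXg Z), fun h => h2 (h ▸ hXg Z)⟩)
    (I := O) (A := A) trivial ⟨hgd ▸ hA, trivial⟩
  have hdil : 𝒜.IsDil f := fun X Y => hf2 X trivial Y trivial
  have off : ∀ X, X ∉ d → f X ≠ X := by
    intro X hX h
    obtain ⟨p, hp, hXp, hOp⟩ := 𝒜.exists_line X O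
    have h1 := hdil X O
    rw [h, hfI] at h1
    have := h1.mem hp hXp hOp (fun h => hX (h ▸ hO)) hXp
    exact hX (line_unique hp hd hOA hOp this hO hA ▸ hXp)
  refine ⟨f, ⟨hdil, Or.inr fun X hX => ?_⟩, hfI⟩
  by_cases hXd : X ∈ d
  · obtain ⟨Y, hY⟩ := exists_notMem hd
    obtain ⟨p, hp, hXp, hYp⟩ := 𝒜.exists_line X Y
    have := hdil.map_mem hp hXp (hX.symm ▸ hXp) hYp
    have hpg := line_unique hp (hg Y) (off Y hY) this hYp (hf1 Y trivial).1 (hXg Y)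
    exact hY ((hdg Y).eq_of_mem hXd (hpg ▸ hXp) ▸ hXg Y)
  · exact off X hXd hX

end DesarguesAffinePlane

namespace DesarguesAffinePlane

open AffinePlane

variable {P : Type*} {𝒜 : DesarguesAffinePlane P}

theorem exists_inverse_translation (hcard : 4 < ENat.card P) {f : P → P} (hf : 𝒜.IsTrans f) :
    ∃ g, 𝒜.IsTrans g ∧ f ∘ g = id ∧ g ∘ f = id := by
  obtain ⟨O, -⟩ := 𝒜.exists_noncollinear
  obtain ⟨g, hg, h⟩ := exists_translation (𝒜 := 𝒜) hcard (f O) O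
  exact ⟨g, hg, (hf.comp hg).eq_id (A := f O) (by simp [h]), (hg.comp hf).eq_id (A := O) h⟩

theorem IsDil.exists_inverse {f : P → P} (hf : 𝒜.IsDil f) {O I : P} (hOI : O ≠ I)
    (hO : f O = O) (hI : f I ≠ O) : ∃ g, 𝒜.IsDil g ∧ g O = O ∧ f ∘ g = id ∧ g ∘ f = id := by
  obtain ⟨l, hl, hOl, hIl⟩ := 𝒜.exists_line O I
  obtain ⟨g, hg, hgO, hgI⟩ := exists_homothety (𝒜 := 𝒜) hl hOl
    (hf.map_mem hl hOl (hO.symm ▸ hOl) hIl) hIl hI.symm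
  refine ⟨g, hg, hgO, ?_, ?_⟩
  · exact (hf.comp hg).ext (isDil_id _) hI.symm (by simp [hgO, hO]) (by simp [hgI])
  · exact (hg.comp hf).ext (isDil_id _) hOI (by simp [hgO, hO]) (by simp [hgI])

section TranslationFamily

variable {O : P} {T : P → P → P} (hT : ∀ A, 𝒜.IsTrans (T A)) (hTO : ∀ A, T A O = A)

include hT hTO

theorem translation_zero : T O = id := (hT O).eq_id (hTO O)

theorem translation_eq {f : P → P} (hf : 𝒜.IsTrans f) : T (f O) = f :=
  (hT _).ext hf (hTO _)

theorem translation_assoc (A B C : P) : T (T A B) C = T A (T B C) :=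
  congrFun ((hT (T A B)).ext ((hT A).comp (hT B)) (A := O) (by simp [hTO])) C

theorem translation_comm (hcard : 4 < ENat.card P) (A B : P) : T A B = T B A := by
  by_cases hA : A = O
  · subst hA
    rw [translation_zero hT hTO, hTO, id]
  by_cases hB : B = O
  · subst hB
    rw [translation_zero hT hTO, hTO, id]
  have off : ∀ {A C}, ¬ 𝒜.ParPts O A O C → T A ∘ T C = T C ∘ T A := fun {A C} h =>
    (hT A).comm_of_not_parPts (hT C) (A := O) (by rwa [hTO, hTO])
  suffices T A ∘ T B = T B ∘ T A by
    have := congrFun this O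
    simpa [hTO] using this
  by_cases h : 𝒜.ParPts O A O B
  · obtain ⟨l, hl, hOl, hAl⟩ := 𝒜.exists_line O A
    have hBl := h.mem hl hOl hAl (Ne.symm hA) hOl
    obtain ⟨C, hC⟩ := exists_notMem hl
    have h1 := off (ParPts.not_of_notMem hl hOl hAl (Ne.symm hA) hOl hC)
    have hBC : T B C ∉ l := fun hBC => hC <| by
      have := (hT B).parPts_trace O C
      rw [hTO] at this
      exact this.swap_right.mem hl hOl hBl (Ne.symm hB) hBC
    have h2 := off (ParPts.not_of_notMem hl hOl hAl (Ne.symm hA) hOl hBC)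
    rw [show T (T B C) = T B ∘ T C from funext (translation_assoc hT hTO B C)] at h2
    obtain ⟨g, -, hg, -⟩ := exists_inverse_translation hcard (hT C)
    calc T A ∘ T B = (T A ∘ (T B ∘ T C)) ∘ g := by
          rw [Function.comp_assoc, Function.comp_assoc, hg, Function.comp_id]
      _ = T B ∘ (T A ∘ T C) ∘ g := by rw [h2, h1]; rfl
      _ = T B ∘ T A := by rw [Function.comp_assoc, hg, Function.comp_id]
  · exact off h

theorem IsDil.map_translation {f : P → P} (hf : 𝒜.IsDil f) {I : P} (hOI : O ≠ I) (hO : f O = O)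
    (A B : P) : f (T A B) = T (f A) (f B) := by
  by_cases hI : f I = O
  · rw [hf.ext (isDil_const 𝒜.toAffinePlane O) hOI hO hI, hTO]
  obtain ⟨g, hg, hgO, hfg, hgf⟩ := IsDil.exists_inverse hf hOI hO hI
  have h : 𝒜.IsTrans (f ∘ T A ∘ g) := by
    refine ⟨hf.comp ((hT A).1.comp hg), ?_⟩
    rcases (hT A).2 with h | h
    · left
      rw [h, Function.id_comp, hfg]
    · right
      intro X hX
      refine h (g X) ?_
      have := congrArg g hX
      rwa [Function.comp_apply, ← Function.comp_apply (f := g) (g := f), hgf] at this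
  have h' := translation_eq hT hTO h
  simp only [Function.comp_apply, hgO, hTO] at h'
  rw [h', Function.comp_apply, Function.comp_apply, ← Function.comp_apply (f := g) (g := f), hgf, id]

theorem isDil_add (hcard : 4 < ENat.card P) {f g : P → P} (hf : 𝒜.IsDil f) (hg : 𝒜.IsDil g) :
    𝒜.IsDil fun X => T (f X) (g X) := by
  intro X Y
  by_cases h : X = Y
  · subst h
    exact ParPts.self_right _ _ _ _
  · refine ParPts.concat h ((hT (f X)).1.parPts (hg X Y)) ?_
    beta_reduce
    rw [translation_comm hT hTO hcard (f X), translation_comm hT hTO hcard (f Y)]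
    exact (hT (g Y)).1.parPts (hf X Y)

end TranslationFamily

end DesarguesAffinePlane

/-- `DivisionRing` from a minimal set of laws. -/
abbrev DivisionRing.ofMinimalAxioms (K : Type*) [Add K] [Mul K] [Neg K] [Inv K] [Zero K] [One K]
    (add_assoc : ∀ a b c : K, a + b + c = a + (b + c))
    (zero_add : ∀ a : K, 0 + a = a)
    (neg_add_cancel : ∀ a : K, -a + a = 0)
    (mul_assoc : ∀ a b c : K, a * b * c = a * (b * c))
    (one_mul : ∀ a : K, 1 * a = a)
    (mul_one : ∀ a : K, a * 1 = a)
    (mul_inv_cancel : ∀ a : K, a ≠ 0 → a * a⁻¹ = 1)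
    (inv_zero : (0 : K)⁻¹ = 0)
    (left_distrib : ∀ a b c : K, a * (b + c) = a * b + a * c)
    (right_distrib : ∀ a b c : K, (a + b) * c = a * c + b * c)
    (exists_pair_ne : ∃ x y : K, x ≠ y) : DivisionRing K :=
  letI := Ring.ofMinimalAxioms add_assoc zero_add neg_add_cancel mul_assoc one_mul mul_one
    left_distrib right_distrib
  { exists_pair_ne := exists_pair_ne
    mul_inv_cancel := mul_inv_cancel
    inv_zero := inv_zero
    nnqsmul := _
    nnqsmul_def := fun _ _ => rfl
    qsmul := _
    qsmul_def := fun _ _ => rfl }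

theorem IsOrderedLine.not_rotate {K : Type*} {btw : K → K → K → Prop}
    (h : IsOrderedLine btw Set.univ) {a b c : K} (habc : btw a b c) :
    ¬ btw b c a ∧ ¬ btw c a b := by
  obtain ⟨h1, h2, h3⟩ := h.distinct a trivial b trivial c trivial habc
  have := h.exactly_one a trivial b trivial c trivial h1 h2 h3
  tauto

section OrderedDivisionRing

variable {K : Type*} [DivisionRing K] {btw : K → K → K → Prop}

/-- In an ordered division ring line with a third element, the characteristic is not two. -/
theorem two_ne_zero_of_btw (h : IsOrderedLine btw Set.univ)
    (hadd : ∀ a b c d, btw a b c → btw (a + d) (b + d) (c + d))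
    (hK : ∃ x : K, x ≠ 0 ∧ x ≠ 1) : (1 : K) + 1 ≠ 0 := by
  intro h2
  have e : ∀ y : K, y + y = 0 := fun y => by rw [← two_mul, ← one_add_one_eq_two, h2, zero_mul]
  have key : ∀ a b c, ¬ btw a b c := by
    intro a b c habc
    have h1 := hadd _ _ _ (a + b) habc
    have h2 := hadd _ _ _ (b + c) habc
    rw [← add_assoc, e, zero_add, add_comm a b, ← add_assoc, e, zero_add] at h1
    rw [add_comm b c, add_comm b, add_assoc, e, add_zero, ← add_assoc c, e, zero_add] at h2
    have h3 : a + (c + b) = c + (b + a) := by abel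
    rw [h3] at h2
    have h4 := (h.chain _ trivial _ trivial _ trivial _ trivial habc
      (h.symm _ trivial _ trivial _ trivial h2)).1
    exact (h.not_rotate h4).2 (h.symm _ trivial _ trivial _ trivial h1)
  obtain ⟨x, hx, hx'⟩ := hK
  rcases h.exactly_one 0 trivial 1 trivial x trivial zero_ne_one hx'.symm hx.symm with
    h | h | h
  · exact key _ _ _ h.1
  · exact key _ _ _ h.2.1
  · exact key _ _ _ h.2.2

theorem btw_neg_of_btw (h : IsOrderedLine btw Set.univ)
    (hadd : ∀ a b c d, btw a b c → btw (a + d) (b + d) (c + d))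
    (hmul : ∀ a b c d, d ≠ 0 → btw a b c → btw (a * d) (b * d) (c * d))
    (hK : ∃ x : K, x ≠ 0 ∧ x ≠ 1) {x : K} (hx : x ≠ 0) : btw x 0 (-x) := by
  have h2 := two_ne_zero_of_btw h hadd hK
  suffices btw (-1) 0 1 by
    have := h.symm _ trivial _ trivial _ trivial (hmul _ _ _ x hx this)
    simpa using this
  have key : ∀ {y : K}, y = 1 ∨ y = -1 → ¬ btw 0 y (-y) := by
    intro y hy h0
    have h1 := h.symm _ trivial _ trivial _ trivial (hmul _ _ _ (-1) (by simp) h0)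
    simp only [mul_neg, mul_one, neg_neg, neg_zero] at h1
    exact (h.not_rotate h0).1 h1
  rcases h.exactly_one (-1) trivial 0 trivial 1 trivial (by simp) (by simp)
    (fun h => h2 (by nth_rewrite 1 [← h]; exact neg_add_cancel 1)) with h | h | h'
  · exact h.1
  · exact (key (Or.inl rfl) h.2.1).elim
  · have := h.symm _ trivial _ trivial _ trivial h'.2.2
    exact (key (Or.inr rfl) (by simpa using this)).elim

/-- A division ring carrying a linear betweenness relation that is invariant under translations
and right multiplications is ordered. -/
theorem isOrderedSkewField_of_btw (h : IsOrderedLine btw Set.univ)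
    (hadd : ∀ a b c d, btw a b c → btw (a + d) (b + d) (c + d))
    (hmul : ∀ a b c d, d ≠ 0 → btw a b c → btw (a * d) (b * d) (c * d))
    (hK : ∃ x : K, x ≠ 0 ∧ x ≠ 1) :
    IsOrderedSkewField K {x | btw x 0 1} {x | btw 0 x 1 ∨ x = 1 ∨ btw 0 1 x} := by
  have symm : ∀ {a b c}, btw a b c → btw c b a := fun {a b c} => h.symm a trivial b trivial c trivial
  have dist : ∀ {a b c}, btw a b c → a ≠ b ∧ b ≠ c ∧ a ≠ c := fun {a b c} =>
    h.distinct a trivial b trivial c trivial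
  have chain : ∀ {a b c d}, btw a b c → btw b c d → btw a b d ∧ btw a c d := fun {a b c d} =>
    h.chain a trivial b trivial c trivial d trivial
  have neg : ∀ {x}, x ≠ 0 → btw x 0 (-x) := btw_neg_of_btw h hadd hmul hK
  have opp : ∀ {a b c}, btw a 0 b → btw b 0 c → ¬ btw a 0 c := by
    intro a b c h1 h2 h3
    rcases h.same_side a trivial 0 trivial b trivial c trivial (dist h3).2.2 h1 h2 with h4 | h4
    · exact (h.not_rotate h3).2 h4
    · exact (h.not_rotate h3).1 (symm h4)
  have sep : ∀ {a b c}, b ≠ 0 → btw a 0 c → btw a 0 b ∨ btw b 0 c := by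
    intro a b c hb hac
    by_contra! hn
    have side : ∀ {a c}, btw a 0 c → ¬ btw a 0 b → ¬ btw b 0 c → btw 0 b a := by
      intro a c hac h1 h2
      have hab : a ≠ b := by
        rintro rfl
        exact h2 hac
      rcases h.exactly_one a trivial 0 trivial b trivial (dist hac).1 hb.symm hab with h3 | h3 | h3
      · exact (h1 h3.1).elim
      · exact h3.2.1
      · exact (h2 (chain h3.2.2 hac).2).elim
    have h1 := side hac hn.1 hn.2
    have h2 := side (symm hac) (fun h => hn.2 (symm h)) (fun h => hn.1 (symm h))
    exact opp (chain (symm h1) (neg hb)).2 (chain (symm (neg hb)) h2).1 hac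
  have mem_pos : ∀ {x}, (btw 0 x 1 ∨ x = 1 ∨ btw 0 1 x) ↔ x ≠ 0 ∧ ¬ btw x 0 1 := by
    intro x
    constructor
    · rintro (h1 | rfl | h1)
      · exact ⟨(dist h1).1.symm, fun h2 => (h.not_rotate h1).2 (symm h2)⟩
      · exact ⟨one_ne_zero, fun h2 => (dist h2).2.2 rfl⟩
      · exact ⟨(dist h1).2.2.symm, (h.not_rotate h1).2⟩
    · rintro ⟨hx, h1⟩
      by_cases hx1 : x = 1
      · exact Or.inr (Or.inl hx1)
      · rcases h.exactly_one 0 trivial x trivial 1 trivial hx.symm hx1 zero_ne_one with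
          h3 | h3 | h3
        · exact Or.inl h3.1
        · exact Or.inr (Or.inr (symm h3.2.1))
        · exact (h1 (symm h3.2.2)).elim
  refine ⟨?_, fun h0 => (dist h0).1 rfl, fun h0 => (mem_pos.1 h0).1 rfl, ?_, ?_, ?_, ?_⟩
  · refine Set.eq_univ_of_forall fun x => ?_
    by_cases hx : x = 0
    · exact Or.inl (Or.inr hx)
    by_cases hx' : btw x 0 1
    · exact Or.inl (Or.inl hx')
    · exact Or.inr (mem_pos.2 ⟨hx, hx'⟩)
  · exact Set.eq_empty_iff_forall_notMem.2 fun x hx => (mem_pos.1 hx.2).2 hx.1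
  · intro x hx y hy
    obtain ⟨hx, hx'⟩ := mem_pos.1 hx
    obtain ⟨hy, hy'⟩ := mem_pos.1 hy
    have hxy : ¬ btw x 0 y := fun h1 =>
      (sep one_ne_zero h1).elim hx' fun h2 => hy' (symm h2)
    refine mem_pos.2 ⟨fun h0 => ?_, fun h1 => ?_⟩
    · exact hxy (by rw [← neg_eq_of_add_eq_zero_right h0]; exact neg hx)
    · have h2 := (sep hx h1).resolve_right hx'
      have h3 := hadd _ _ _ (-x) h2
      simp only [zero_add, add_neg_cancel, add_neg_cancel_comm] at h3
      exact hxy (symm (chain h3 (symm (neg hx))).2)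
  · intro x hx y hy
    obtain ⟨hx, hx'⟩ := mem_pos.1 hx
    obtain ⟨hy, hy'⟩ := mem_pos.1 hy
    refine mem_pos.2 ⟨mul_ne_zero hx hy, fun h1 => ?_⟩
    have h2 := (sep hy h1).resolve_right hy'
    have h3 := hmul _ _ _ y⁻¹ (inv_ne_zero hy) h2
    simp only [mul_assoc, mul_inv_cancel₀ hy, mul_one, zero_mul] at h3
    exact hx' h3
  · intro x
    refine ⟨fun h1 => mem_pos.2 ⟨neg_ne_zero.2 (dist h1).1, fun h2 => ?_⟩, fun h1 => ?_⟩
    · exact opp (symm h1) (neg (dist h1).1) (symm h2)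
    · obtain ⟨hx, hx'⟩ := mem_pos.1 h1
      exact (sep one_ne_zero (neg (neg_ne_zero.1 hx))).resolve_right fun h => hx' (symm h)

end OrderedDivisionRing

namespace AffinePlane

variable {P : Type*} {𝒜 : AffinePlane P}

theorem not_parallel_of_mem {d l : Set P} {A B : P} (hA : A ∈ d) (hAl : A ∈ l) (hB : B ∈ d)
    (hBl : B ∉ l) : ¬ Parallel d l :=
  fun h => hBl (h.eq_of_mem hA hAl ▸ hB)

/-- Parallel projections, given pointwise, carry over betweenness. -/
theorem IsOrdered.btw_of_parPts {btw : P → P → P → Prop} (hord : 𝒜.IsOrdered btw) {d l₁ l₂ : Set P}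
    (hd : d ∈ 𝒜.lines) (hl₁ : l₁ ∈ 𝒜.lines) (hl₂ : l₂ ∈ 𝒜.lines) (h₁ : ¬ Parallel d l₁)
    (h₂ : ¬ Parallel d l₂) {U V : P} (hU : U ∈ d) (hV : V ∈ d) (hUV : U ≠ V)
    {X Y Z X' Y' Z' : P} (hX : X ∈ l₁) (hY : Y ∈ l₁) (hZ : Z ∈ l₁) (hX' : X' ∈ l₂) (hY' : Y' ∈ l₂)
    (hZ' : Z' ∈ l₂) (hXX' : 𝒜.ParPts U V X X') (hYY' : 𝒜.ParPts U V Y Y')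
    (hZZ' : 𝒜.ParPts U V Z Z') (h : btw X Y Z) : btw X' Y' Z' := by
  choose n hn hXn hdn using exists_parallel hd
  have hne : ∀ X, ¬ Parallel (n X) l₂ := fun X h => h₂ ((hdn X).trans hd (hn X) hl₂ h)
  have hf : ∀ X : l₁, ∃ X' : l₂, (X' : P) ∈ n X := fun X => by
    obtain ⟨X', h1, h2⟩ := Set.nonempty_iff_ne_empty.2 fun h => hne X (Or.inr h)
    exact ⟨⟨X', h2⟩, h1⟩
  choose f hf using hf
  have hfe : ∀ (X : l₁) X', X' ∈ l₂ → 𝒜.ParPts U V X X' → (f X : P) = X' := by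
    intro X X' hX' hp
    by_contra h
    exact hne X (Or.inl (line_unique (hn X) hl₂ h (hf X)
      (hp.mem_of_parallel hd (hn X) (hdn X) hU hV hUV (hXn X)) (f X).2 hX'))
  have := hord.2 d hd l₁ hl₁ l₂ hl₂ f
    ⟨h₁, h₂, fun X => ⟨n X, hn X, (hdn X).symm, hXn X, hf X⟩⟩ ⟨X, hX⟩ ⟨Y, hY⟩ ⟨Z, hZ⟩ h
  rwa [hfe ⟨X, hX⟩ X' hX' hXX', hfe ⟨Y, hY⟩ Y' hY' hYY', hfe ⟨Z, hZ⟩ Z' hZ' hZZ'] at this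

end AffinePlane

namespace DesarguesAffinePlane

open AffinePlane

variable {P : Type*} {𝒜 : DesarguesAffinePlane P}

/-- The points of a line of a Desargues plane with more than four points form the skew field with
the geometric operations. -/
theorem exists_isConstructedSkewField (hcard : 4 < ENat.card P) {l : Set P} (hl : l ∈ 𝒜.lines)
    (O I : l) (hOI : O ≠ I) :
    ∃ _ : DivisionRing l, 𝒜.IsConstructedSkewField l O I := by
  classical
  have hOI' : (O : P) ≠ I := fun h => hOI (Subtype.ext h)
  choose T hT hTO using exists_translation (𝒜 := 𝒜) hcard (O : P)
  choose H hH hHO hHI using fun A : l => exists_homothety (𝒜 := 𝒜) hl O.2 I.2 A.2 hOI'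
  have hTl : ∀ A C : l, T A C ∈ l := fun A C =>
    (hT A).1.map_mem hl O.2 ((hTO A).symm ▸ A.2) C.2
  have hHl : ∀ A C : l, H A C ∈ l := fun A C =>
    (hH A).map_mem hl O.2 ((hHO A).symm ▸ O.2) C.2
  have hHeq : ∀ (A : l) (f : P → P), 𝒜.IsDil f → f O = O → f I = A → f = H A := fun A f hf h h' =>
    hf.ext (hH A) hOI' (h.trans (hHO A).symm) (h'.trans (hHI A).symm)
  have hneg : ∀ A : l, ∃ B : l, T B A = O := fun A => by
    obtain ⟨f, hf, hfA⟩ := exists_translation (𝒜 := 𝒜) hcard (A : P) O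
    refine ⟨⟨f O, hf.1.map_mem hl A.2 (hfA.symm ▸ O.2) O.2⟩, ?_⟩
    rw [translation_eq hT hTO hf, hfA]
  choose N hN using hneg
  have hinv : ∀ A : l, ∃ B : l, (A ≠ O → H A B = I) ∧ (A = O → B = O) := fun A => by
    by_cases hA : A = O
    · exact ⟨O, fun h => (h hA).elim, fun _ => rfl⟩
    · obtain ⟨g, hg, hgO, h, -⟩ := IsDil.exists_inverse (hH A) hOI' (hHO A)
        fun h => hA (Subtype.ext ((hHI A).symm.trans h))
      exact ⟨⟨g I, hg.map_mem hl O.2 (hgO.symm ▸ O.2) I.2⟩, fun _ => congrFun h I,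
        fun h => (hA h).elim⟩
  choose V hV hVO using hinv
  let _ : Add l := ⟨fun A C => ⟨T A C, hTl A C⟩⟩
  let _ : Mul l := ⟨fun A C => ⟨H A C, hHl A C⟩⟩
  let _ : Zero l := ⟨O⟩
  let _ : One l := ⟨I⟩
  let _ : Neg l := ⟨N⟩
  let _ : Inv l := ⟨V⟩
  have add_def : ∀ A C : l, ((A + C : l) : P) = T A C := fun _ _ => rfl
  have mul_def : ∀ A C : l, ((A * C : l) : P) = H A C := fun _ _ => rfl
  let _ : DivisionRing l := DivisionRing.ofMinimalAxioms l
    (fun A B C => Subtype.ext (translation_assoc hT hTO A B C))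
    (fun A => Subtype.ext (congrFun (translation_zero hT hTO) A))
    (fun A => Subtype.ext (hN A))
    (fun A B C => Subtype.ext (congrFun (hHeq (A * B) _ ((hH A).comp (hH B))
      (by simp [hHO]) (by simp [hHI, mul_def])).symm C))
    (fun A => Subtype.ext (congrFun (hHeq I id (isDil_id _) rfl rfl) A).symm)
    (fun A => Subtype.ext (hHI A))
    (fun A hA => Subtype.ext (hV A hA))
    (hVO O rfl)
    (fun A B C => Subtype.ext (IsDil.map_translation hT hTO (hH A) hOI' (hHO A) B C))
    (fun A B C => Subtype.ext (congrFun (hHeq (A + B) _ (isDil_add hT hTO hcard (hH A) (hH B))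
      (by simp [hHO, hTO]) (by simp [hHI, add_def])).symm C))
    ⟨O, I, hOI⟩
  have hne : ∀ {B : P} (X : l), B ∉ l → (X : P) ≠ B := fun X hB h => hB (h ▸ X.2)
  have hnp : ∀ {B : P} (X : l), B ∉ l → ¬ 𝒜.ParPts (O : P) I X B := fun X hB =>
    ParPts.not_of_notMem hl O.2 I.2 hOI' X.2 hB
  refine ⟨inferInstance, rfl, rfl, fun A C E => ⟨?_, ?_⟩, fun A C F => ⟨?_, ?_⟩⟩
  · rintro rfl
    obtain ⟨B, hB⟩ := exists_notMem hl
    refine ⟨B, hB, T A B, ?_, ?_, ?_⟩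
    · by_cases hA : (O : P) = A
      · rw [← hA, translation_zero hT hTO]
        exact ParPts.self_left _ _ _ _
      · have := (hT A).parPts_trace O B
        rw [hTO] at this
        exact this.symm.trans hA (ParPts.of_mem hl O.2 A.2 O.2 I.2)
    · have := (hT A).1 O B
      rw [hTO] at this
      exact this.symm
    · exact ((hT A).1 C B).symm.swap_left
  · rintro ⟨B, hB, D, h1, h2, h3⟩
    have hD : D = T A B := by
      refine ParPts.inter_unique hOI' (hne O hB) (hnp O hB) h1.symm ?_ h2.symm ?_ (A := B) (B := A)
      · by_cases hA : (O : P) = A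
        · rw [← hA, translation_zero hT hTO]
          exact ParPts.self_right _ _ _ _
        · have := (hT A).parPts_trace O B
          rw [hTO] at this
          exact (ParPts.of_mem hl O.2 I.2 O.2 A.2).trans hA this
      · simpa only [hTO] using (hT A).1 O B
    subst hD
    refine Subtype.ext (ParPts.inter_unique hOI' (hne C hB) (hnp C hB) (A := (O : P))
      (ParPts.of_mem hl O.2 I.2 O.2 (hTl A C)) (ParPts.of_mem hl O.2 I.2 O.2 E.2)
      (B := T A B) ?_ h3.symm)
    exact ((hT A).1 C B).swap_right
  · rintro rfl
    obtain ⟨B, hB⟩ := exists_notMem hl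
    refine ⟨B, hB, H A B, ?_, ?_, ?_⟩
    · have := (hH A) I B
      rw [hHI] at this
      exact this.symm
    · obtain ⟨m, hm, hO, hB⟩ := 𝒜.exists_line O B
      exact ⟨m, hm, hO, hB, (hH A).map_mem hm hO ((hHO A).symm ▸ hO) hB⟩
    · exact ((hH A) B C).symm
  · rintro ⟨B, hB, E, h1, ⟨m, hm, hOm, hBm, hEm⟩, h3⟩
    have hE : E = H A B := by
      refine ParPts.inter_unique (hne I hB) (hne O hB) (fun h => ?_) h1.symm ?_
        (ParPts.of_mem hm hOm hBm hOm hEm)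
        (ParPts.of_mem hm hOm hBm hOm ((hH A).map_mem hm hOm ((hHO A).symm ▸ hOm) hBm))
      · have hI := h.symm.swap_right.mem hm hOm hBm (hne O hB) hBm
        exact hB (line_unique hm hl hOI' hOm hI O.2 I.2 ▸ hBm)
      · simpa only [hHI] using hH A I B
    subst hE
    refine Subtype.ext (ParPts.inter_unique hOI' (hne C hB) (hnp C hB) (A := (O : P))
      (ParPts.of_mem hl O.2 I.2 O.2 (hHl A C)) (ParPts.of_mem hl O.2 I.2 O.2 F.2)
      (B := H A B) ?_ h3.symm.swap_left)
    exact (hH A B C).swap_left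

end DesarguesAffinePlane

namespace AffinePlane

variable {P : Type*} {𝒜 : AffinePlane P}

theorem exists_third_point (hcard : 4 < ENat.card P) {l : Set P} (hl : l ∈ 𝒜.lines) {O I : P}
    (hO : O ∈ l) (hI : I ∈ l) (hOI : O ≠ I) : ∃ X ∈ l, X ≠ O ∧ X ≠ I := by
  obtain ⟨B, hB⟩ := exists_notMem hl
  obtain ⟨d, hd, hOd, hBd⟩ := 𝒜.exists_line O B
  obtain ⟨d', hd', hId', hdd'⟩ := exists_parallel hd I
  obtain ⟨Z, hZ, hZ'⟩ := exists_notMem_of_parallel hcard hd hd' hdd'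
  obtain ⟨X, h1, h2⟩ := ParPts.exists_inter (𝒜 := 𝒜) (U := O) (V := B) (W := O) (Z := I) Z O
    fun h => ParPts.not_of_notMem hl hO hI hOI hO hB h.symm
  have hOB : O ≠ B := fun h => hB (h ▸ hO)
  refine ⟨X, h2.mem hl hO hI hOI hO, ?_, ?_⟩
  · rintro rfl
    exact hZ (h1.swap_right.mem hd hOd hBd hOB hOd)
  · rintro rfl
    exact hZ' (h1.swap_right.mem_of_parallel hd hd' hdd' hOd hBd hOB hId')

section Btw

variable {btw : P → P → P → Prop} {l : Set P} {O I : l}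

theorem IsOrdered.btw_add (hord : 𝒜.IsOrdered btw) (hl : l ∈ 𝒜.lines) (hOI : O ≠ I)
    [DivisionRing l] (hK : 𝒜.IsConstructedSkewField l O I) {X Y Z : l} (C : l)
    (h : btw X Y Z) : btw (X + C : l) (Y + C : l) (Z + C : l) := by
  have hOI' : (O : P) ≠ I := fun h => hOI (Subtype.ext h)
  obtain ⟨B, hB⟩ := exists_notMem hl
  have hne : ∀ X : l, (X : P) ≠ B := fun X h => hB (h ▸ X.2)
  have hnp : ∀ X : l, ¬ 𝒜.ParPts (O : P) I X B := fun X =>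
    ParPts.not_of_notMem hl O.2 I.2 hOI' X.2 hB
  obtain ⟨m, hm, hBm, hlm⟩ := exists_parallel hl B
  have hstep : ∀ A : l, ∃ D ∈ m, 𝒜.ParPts O B A D ∧ 𝒜.ParPts C B D (A + C : l) := fun A => by
    obtain ⟨D, h1, h2⟩ := ParPts.exists_inter B (A : P) (hnp O)
    obtain ⟨E, h3, h4⟩ := ParPts.exists_inter D (O : P) fun h => hnp C h.symm
    have hE := h4.mem hl O.2 I.2 hOI' O.2
    rw [(hK.add_iff A C ⟨E, hE⟩).2 ⟨B, hB, D, h1.symm, h2.symm, h3.symm⟩]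
    exact ⟨D, h1.mem_of_parallel hl hm hlm O.2 I.2 hOI' hBm, h2, h3⟩
  choose D hD h1 h2 using hstep
  obtain ⟨d, hd, hOd, hBd⟩ := 𝒜.exists_line O B
  obtain ⟨e, he, hCe, hBe⟩ := 𝒜.exists_line C B
  have hdl := not_parallel_of_mem hOd O.2 hBd hB
  have hel := not_parallel_of_mem hCe C.2 hBe hB
  exact hord.btw_of_parPts he hm hl (fun h => hel (h.trans he hm hl hlm.symm)) hel hCe hBe (hne C)
    (hD X) (hD Y) (hD Z) (X + C).2 (Y + C).2 (Z + C).2 (h2 X) (h2 Y) (h2 Z) <|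
    hord.btw_of_parPts hd hl hm hdl (fun h => hdl (h.trans hd hm hl hlm.symm)) hOd hBd (hne O)
      X.2 Y.2 Z.2 (hD X) (hD Y) (hD Z) (h1 X) (h1 Y) (h1 Z) h

theorem IsOrdered.btw_mul (hord : 𝒜.IsOrdered btw) (hl : l ∈ 𝒜.lines) (hOI : O ≠ I)
    [DivisionRing l] (hK : 𝒜.IsConstructedSkewField l O I) {X Y Z : l} {C : l} (hC : C ≠ O)
    (h : btw X Y Z) : btw (X * C : l) (Y * C : l) (Z * C : l) := by
  obtain ⟨B, hB⟩ := exists_notMem hl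
  have hne : ∀ X : l, (X : P) ≠ B := fun X h => hB (h ▸ X.2)
  have hOI' : (O : P) ≠ I := fun h => hOI (Subtype.ext h)
  obtain ⟨m, hm, hOm, hBm⟩ := 𝒜.exists_line O B
  have hml : ∀ A : l, A ≠ O → (A : P) ∉ m := fun A hA h =>
    hB (line_unique hm hl (fun h => hA (Subtype.ext h)) h hOm A.2 O.2 ▸ hBm)
  have hstep : ∀ A : l, ∃ E ∈ m, 𝒜.ParPts I B A E ∧ 𝒜.ParPts C B E (A * C : l) := fun A => by
    obtain ⟨E, h1, h2⟩ := ParPts.exists_inter (𝒜 := 𝒜) (U := I) (V := B) (W := O) (Z := B) A O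
      fun h => ParPts.not_of_notMem hm hOm hBm (hne O) hBm (hml I hOI.symm) h.symm.swap_right
    obtain ⟨F, h3, h4⟩ := ParPts.exists_inter (𝒜 := 𝒜) (U := C) (V := B) (W := O) (Z := I) E O
      fun h => ParPts.not_of_notMem hl O.2 I.2 hOI' C.2 hB h.symm
    have hF := h4.mem hl O.2 I.2 hOI' O.2
    have hE := h2.mem hm hOm hBm (hne O) hOm
    rw [(hK.mul_iff A C ⟨F, hF⟩).2 ⟨B, hB, E, h1.symm, ⟨m, hm, hOm, hBm, hE⟩,
      h3.symm.swap_right⟩]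
    exact ⟨E, hE, h1, h3⟩
  choose E hE h1 h2 using hstep
  obtain ⟨d, hd, hId, hBd⟩ := 𝒜.exists_line I B
  obtain ⟨e, he, hCe, hBe⟩ := 𝒜.exists_line C B
  exact hord.btw_of_parPts he hm hl (not_parallel_of_mem hBe hBm hCe (hml C hC))
    (not_parallel_of_mem hCe C.2 hBe hB) hCe hBe (hne C)
    (hE X) (hE Y) (hE Z) (X * C).2 (Y * C).2 (Z * C).2 (h2 X) (h2 Y) (h2 Z) <|
    hord.btw_of_parPts hd hl hm (not_parallel_of_mem hId I.2 hBd hB)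
      (not_parallel_of_mem hBd hBm hId (hml I hOI.symm)) hId hBd (hne I)
      X.2 Y.2 Z.2 (hE X) (hE Y) (hE Z) (h1 X) (h1 Y) (h1 Z) h

end Btw

end AffinePlane

open AffinePlane in
theorem mainTheorem1 {P : Type*} (𝒜 : DesarguesAffinePlane P)
    (btw : P → P → P → Prop) (hord : 𝒜.toAffinePlane.IsOrdered btw)
    (hcard : 4 < ENat.card P)
    (l : Set P) (hl : l ∈ 𝒜.lines) (O I : l) (hOI : O ≠ I) :
    ∃ _ : DivisionRing l,
      𝒜.toAffinePlane.IsConstructedSkewField l O I ∧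
      IsOrderedSkewField l (negativePoints btw l O I) (positivePoints btw l O I) := by
  obtain ⟨_, hK⟩ := DesarguesAffinePlane.exists_isConstructedSkewField hcard hl O I hOI
  refine ⟨inferInstance, hK, ?_⟩
  have h1 := hord.1 l hl
  have hline : IsOrderedLine (fun A B C : l => btw A B C) Set.univ := by
    constructor
    · intro A _ B _ C _ h
      obtain ⟨h2, h3, h4⟩ := h1.distinct A A.2 B B.2 C C.2 h
      exact ⟨fun e => h2 (congrArg _ e), fun e => h3 (congrArg _ e), fun e => h4 (congrArg _ e)⟩
    · exact fun A _ B _ C _ => h1.symm A A.2 B B.2 C C.2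
    · exact fun A _ B _ C _ hAB hBC hAC => h1.exactly_one A A.2 B B.2 C C.2
        (fun e => hAB (Subtype.ext e)) (fun e => hBC (Subtype.ext e))
        (fun e => hAC (Subtype.ext e))
    · exact fun A _ B _ C _ D _ => h1.chain A A.2 B B.2 C C.2 D D.2
    · exact fun A _ B _ C _ D _ hAD => h1.same_side A A.2 B B.2 C C.2 D D.2
        (fun e => hAD (Subtype.ext e))
  obtain ⟨X, hX, hXO, hXI⟩ := exists_third_point hcard hl O.2 I.2 fun h => hOI (Subtype.ext h)
  have := isOrderedSkewField_of_btw hline (fun _ _ _ d h => hord.btw_add hl hOI hK d h)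
    (fun _ _ _ d hd h => hord.btw_mul hl hOI hK (fun e => hd (e.trans hK.zero_eq.symm)) h)
    ⟨⟨X, hX⟩, fun e => hXO (congrArg Subtype.val (e.trans hK.zero_eq)),
      fun e => hXI (congrArg Subtype.val (e.trans hK.one_eq))⟩
  rwa [hK.zero_eq, hK.one_eq] at this
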